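/- Let $\bar X$ be a permutation of $[n]=\{1,\dots,n\}$, written as a word $\bar x_1\cdots\bar x_n$. Mark each of its elements independently with probability $p\in[0,1]$, and then permute the marked elements uniformly at random among the places they occupy, the unmarked elements staying in place. Let $X=x_1\cdots x_n$ be the resulting random permutation, and let $\lambda_{\mathrm u}(X)$ be the number of left-to-right maxima of $X$ (elements $x_k$ with $x_j<x_k$ for all $j<k$) that are unmarked. Then, if $p=p(n)\gg n^{-1}$, $$\max_{\bar X}\mathbb E[\lambda_{\mathrm u}(X)]=O\Bigl((1-p)\sqrt{n/p}\Bigr).$$ That is, there is an absolute constant $C$ such that for every sequence $p(n)\in[0,1]$ with $n\,p(n)\to\infty$ one has, for all sufficiently large $n$ (depending on the sequence), $\max_{\bar X}\mathbb E[\lambda_{\mathrm u}(X)]\le C\,(1-p(n))\sqrt{n/p(n)}$, the maximum being over all permutations $\bar X$ of $[n]$. -/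

import Mathlib

open scoped Nat

namespace PartialPermutation

/-- The position `k` holds a left-to-right maximum (a record) of the permutation `x`, written as
the word `x 0, x 1, …, x (n - 1)`. -/
def IsRecord {n : ℕ} (x : Equiv.Perm (Fin n)) (k : Fin n) : Prop :=
  ∀ j : Fin n, j < k → x j < x k

instance {n : ℕ} (x : Equiv.Perm (Fin n)) (k : Fin n) : Decidable (IsRecord x k) :=
  inferInstanceAs (Decidable (∀ j : Fin n, j < k → x j < x k))

/-- The permutation obtained from the word `σ 0, …, σ (n - 1)` by permuting its marked elements
(the elements of `M`) by `τ` among the places they occupy; the unmarked elements stay in place. -/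
def shuffle {n : ℕ} (σ : Equiv.Perm (Fin n)) (M : Finset (Fin n))
    (τ : Equiv.Perm {v : Fin n // v ∈ M}) : Equiv.Perm (Fin n) :=
  Equiv.Perm.ofSubtype τ * σ

/-- The number of left-to-right maxima of `x` that are unmarked elements, `M` being the set of
marked elements. -/
def unmarkedRecords {n : ℕ} (x : Equiv.Perm (Fin n)) (M : Finset (Fin n)) : ℕ :=
  (Finset.univ.filter fun k : Fin n => IsRecord x k ∧ x k ∉ M).card

/-- The probability that `M` is exactly the set of marked elements, when each of the `n` elements
is marked independently with probability `p`. -/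
noncomputable def markProb {n : ℕ} (p : ℝ) (M : Finset (Fin n)) : ℝ :=
  ∏ v : Fin n, if v ∈ M then p else 1 - p

/-- The expected number of unmarked left-to-right maxima, starting from `σ`: the set `M` of marked
elements is drawn by independent marking with probability `p`, and given `M` the permutation `τ`
of the marked elements is uniform among the `M.card !` possible ones. -/
noncomputable def expectedUnmarkedRecords {n : ℕ} (p : ℝ) (σ : Equiv.Perm (Fin n)) : ℝ :=
  ∑ M : Finset (Fin n), markProb p M *
    ((∑ τ : Equiv.Perm {v : Fin n // v ∈ M}, (unmarkedRecords (shuffle σ M τ) M : ℝ)) /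
      (M.card ! : ℝ))

/-- The maximum over all starting permutations of the expected number of unmarked left-to-right
maxima. -/
noncomputable def maxExpectedUnmarkedRecords (n : ℕ) (p : ℝ) : ℝ :=
  (Finset.univ : Finset (Equiv.Perm (Fin n))).sup' Finset.univ_nonempty
    fun σ => expectedUnmarkedRecords p σ

end PartialPermutation

/-! Fix a place `k` with `σ k` unmarked, and let `l` be the number of values above `σ k`. Given `M`
of size `m`, with `i` marked elements placed before `k` and `j` marked values above `σ k`, a record
at `k` forces the shuffle to put none of those `j` values on those `i` places. This has probability
at most `(1 - j/m)^i ≤ exp (-(i*j/m))` (`card_perm_mapsTo_compl_le`). Typically `m ≤ 2pn`, `i ≥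
pk/4` and `j ≥ pl/4`, which gives `exp (-(p*k*l/(32n)))`; the exceptions are paid for by exponential
moments (`sum_markProb_mul_exp_le`), and `σ k` being unmarked supplies the factor `1 - p`. As `k`
varies, `l` takes each value below `n` once. With `K = √(n/p)`, the places with `l ≤ K` number O(K),
and the others decay in `k` at scale `K`, so the sum is O(K). -/

open Real in
theorem sum_exp_neg_mul_le {c : ℝ} (hc : 0 < c) (n : ℕ) :
    ∑ k : Fin n, exp (-(c * (k : ℕ))) ≤ 1 + 1 / c := by
  have h1 : exp (-c) < 1 := by simpa using hc
  have h2 : ∑ k : Fin n, exp (-(c * (k : ℕ))) = ∑ k ∈ Finset.range n, exp (-c) ^ k := by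
    rw [Finset.sum_range]
    refine Finset.sum_congr rfl fun k _ => ?_
    rw [← Real.exp_nat_mul]
    congr 1
    ring
  have h3 : exp (-c) * (1 + c) ≤ 1 := by
    have := Real.add_one_le_exp c
    calc exp (-c) * (1 + c) ≤ exp (-c) * exp c := by gcongr; linarith
      _ = 1 := by rw [← Real.exp_add]; simp
  rw [h2, geom_sum_eq h1.ne]
  rw [← neg_div_neg_eq, div_le_iff₀ (by linarith)]
  have h4 := pow_pos (Real.exp_pos (-c)) n
  have h5 : 1 ≤ (1 + 1 / c) * (1 - exp (-c)) := by
    rw [one_add_div hc.ne', div_mul_eq_mul_div, le_div_iff₀ hc]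
    nlinarith
  linarith

/-! ### Counting permutations with forbidden values -/

/-- Permutations that send `s` into the complement of `b`: each point of `s` costs a factor
`1 - b.card / m`. -/
theorem card_perm_mapsTo_compl_le {α : Type*} [Fintype α] [DecidableEq α] (s b : Finset α) :
    ((Finset.univ.filter fun τ : Equiv.Perm α => ∀ x ∈ s, τ x ∉ b).card : ℝ) ≤
      ((Fintype.card α)! : ℝ) * (1 - (b.card : ℝ) / Fintype.card α) ^ s.card := by
  induction s using Finset.induction_on with
  | empty => simp [Fintype.card_perm]
  | insert a s ha ih =>
    set N := Finset.univ.filter fun τ : Equiv.Perm α => ∀ x ∈ s, τ x ∉ b with hN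
    set N' := Finset.univ.filter fun τ : Equiv.Perm α => ∀ x ∈ insert a s, τ x ∉ b with hN'
    set m := Fintype.card α with hm
    have hmpos : 0 < m := Fintype.card_pos_iff.mpr ⟨a⟩
    have hbm : b.card ≤ m := Finset.card_le_univ b
    have hsm : s.card < m := by
      have := Finset.card_le_univ (insert a s)
      rw [Finset.card_insert_of_notMem ha] at this
      omega
    -- Double count the pairs `(τ, t)` with `τ ∈ N`, `t ∉ s`, `τ t ∉ b`. Swapping `a` and `t` shows
    -- that every `t` contributes equally; every `τ` has `m - s.card - b.card` such `t`.
    have hsym : ∀ t ∈ sᶜ, (N.filter fun τ => τ t ∉ b).card = N'.card := by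
      intro t ht
      rw [Finset.mem_compl] at ht
      refine Finset.card_bij' (fun τ _ => τ * Equiv.swap a t) (fun τ _ => τ * Equiv.swap a t)
        ?_ ?_ ?_ ?_
      · intro τ hτ
        simp only [hN, hN', Finset.mem_filter, Finset.mem_univ, true_and, Finset.mem_insert,
          Equiv.Perm.mul_apply] at hτ ⊢
        rintro x (rfl | hx)
        · simpa using hτ.2
        · rw [Equiv.swap_apply_of_ne_of_ne (by rintro rfl; exact ha hx)
            (by rintro rfl; exact ht hx)]
          exact hτ.1 x hx
      · intro τ hτ
        simp only [hN, hN', Finset.mem_filter, Finset.mem_univ, true_and, Finset.mem_insert,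
          Equiv.Perm.mul_apply] at hτ ⊢
        refine ⟨fun x hx => ?_, by simpa using hτ a (Or.inl rfl)⟩
        rw [Equiv.swap_apply_of_ne_of_ne (by rintro rfl; exact ha hx)
            (by rintro rfl; exact ht hx)]
        exact hτ x (Or.inr hx)
      · intro τ _
        simp [mul_assoc]
      · intro τ _
        simp [mul_assoc]
    have hdeg : ∀ τ ∈ N, (sᶜ.filter fun t => τ t ∉ b).card + s.card + b.card = m := by
      intro τ hτ
      simp only [hN, Finset.mem_filter, Finset.mem_univ, true_and] at hτ
      have h1 : (sᶜ.filter fun t => τ t ∉ b) = (s ∪ b.map τ.symm.toEmbedding)ᶜ := by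
        ext t
        simp
      have h2 : Disjoint s (b.map τ.symm.toEmbedding) := by
        rw [Finset.disjoint_left]
        intro x hx hx'
        simp at hx'
        exact hτ x hx hx'
      have h3 : (s ∪ b.map τ.symm.toEmbedding).card = s.card + b.card := by
        rw [Finset.card_union_of_disjoint h2, Finset.card_map]
      have := Finset.card_add_card_compl (s ∪ b.map τ.symm.toEmbedding)
      rw [h1]
      omega
    have hdc := Finset.sum_card_bipartiteAbove_eq_sum_card_bipartiteBelow
      (s := N) (t := sᶜ) fun (τ : Equiv.Perm α) t => τ t ∉ b
    simp only [Finset.bipartiteAbove, Finset.bipartiteBelow] at hdc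
    rw [Finset.sum_congr rfl hsym, Finset.sum_const, Finset.card_compl, smul_eq_mul, ← hm] at hdc
    have hdc' : (N.card : ℝ) * ((m : ℝ) - s.card - b.card) = ((m : ℝ) - s.card) * N'.card := by
      have : (∑ τ ∈ N, ((sᶜ.filter fun t => τ t ∉ b).card : ℝ)) =
          ((m : ℝ) - s.card) * N'.card := by
        have := congrArg (Nat.cast : ℕ → ℝ) hdc
        push_cast [Nat.cast_sub hsm.le] at this
        exact this
      rw [← this, Finset.sum_congr rfl fun τ hτ => (show _ = (m : ℝ) - s.card - b.card by
        have := congrArg (Nat.cast : ℕ → ℝ) (hdeg τ hτ)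
        push_cast at this
        linarith)]
      rw [Finset.sum_const, nsmul_eq_mul]
    have hm' : (0 : ℝ) < m := by exact_mod_cast hmpos
    have hsm' : (s.card : ℝ) < m := by exact_mod_cast hsm
    have hbm' : (b.card : ℝ) ≤ m := by exact_mod_cast hbm
    have hq : 0 ≤ 1 - (b.card : ℝ) / m := by
      rw [sub_nonneg, div_le_one hm']
      exact hbm'
    -- The exact ratio `(m - s - b)/(m - s)` of cardinalities is at most `1 - b/m`.
    have hstep : (N'.card : ℝ) ≤ N.card * (1 - (b.card : ℝ) / m) := by
      rw [one_sub_div hm'.ne', ← mul_div_assoc, le_div_iff₀ hm']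
      have h0 : (0 : ℝ) ≤ N.card * (s.card * b.card) := by positivity
      refine le_of_mul_le_mul_left ?_ (sub_pos.mpr hsm')
      nlinarith
    rw [Finset.card_insert_of_notMem ha, pow_succ, ← mul_assoc]
    exact hstep.trans (mul_le_mul_of_nonneg_right ih hq)

namespace PartialPermutation
open Real

/-! ### Exponential moments of the random marking -/

theorem markProb_nonneg {n : ℕ} {p : ℝ} (hp : p ∈ Set.Icc (0 : ℝ) 1) (M : Finset (Fin n)) :
    0 ≤ markProb p M :=
  Finset.prod_nonneg fun v _ => by split_ifs <;> linarith [hp.1, hp.2]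

/-- By independence the sum factors: `v` gives `1 - p`, and each element of `S` gives `1 + p (e^t -
1) ≤ exp (p (e^t - 1))`. -/
theorem sum_markProb_mul_exp_le {n : ℕ} {p : ℝ} (hp : p ∈ Set.Icc (0 : ℝ) 1) {v : Fin n}
    {S : Finset (Fin n)} (hv : v ∉ S) (t : ℝ) :
    ∑ M : Finset (Fin n) with v ∉ M, markProb p M * exp (t * (M ∩ S).card) ≤
      (1 - p) * exp (p * S.card * (exp t - 1)) := by
  -- The value 0 at `v` kills the sets containing `v` when the product is expanded.
  set f : Fin n → ℝ := fun u => if u = v then 0 else p * if u ∈ S then exp t else 1 with hf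
  have key : ∑ M : Finset (Fin n) with v ∉ M, markProb p M * exp (t * (M ∩ S).card) =
      ∏ u : Fin n, (f u + (1 - p)) := by
    rw [Finset.prod_add, Finset.powerset_univ, Finset.sum_filter]
    refine Finset.sum_congr rfl fun M _ => ?_
    split_ifs with hM
    · rw [Finset.prod_eq_zero hM (by simp [hf]), zero_mul]
    · have h1 : exp (t * (M ∩ S).card) = ∏ u ∈ M, if u ∈ S then exp t else 1 := by
        rw [mul_comm, Real.exp_nat_mul, Finset.prod_ite_mem, Finset.prod_const]
      have h2 : markProb p M = (∏ u ∈ M, p) * ∏ u ∈ Finset.univ \ M, (1 - p) := by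
        rw [markProb, Finset.prod_ite]
        congr 2
        · ext; simp
        · ext; simp
      rw [h1, h2, mul_right_comm, ← Finset.prod_mul_distrib]
      congr 1
      refine Finset.prod_congr rfl fun u hu => ?_
      have huv : u ≠ v := by
        rintro rfl
        exact hM hu
      simp only [hf, if_neg huv]
  have hle : ∀ u ∈ Finset.univ.erase v,
      f u + (1 - p) ≤ if u ∈ S then exp (p * (exp t - 1)) else 1 := by
    intro u hu
    have huv := Finset.ne_of_mem_erase hu
    simp only [hf, if_neg huv]
    split_ifs
    · linarith [Real.add_one_le_exp (p * (exp t - 1))]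
    · linarith
  have h0 : ∀ u ∈ Finset.univ.erase v, 0 ≤ f u + (1 - p) := by
    intro u _
    have := hp.1
    have := hp.2
    have : 0 ≤ f u := by
      simp only [hf]
      split_ifs <;> positivity
    linarith
  rw [key, ← Finset.mul_prod_erase _ _ (Finset.mem_univ v)]
  have hfv : f v + (1 - p) = 1 - p := by simp [hf]
  rw [hfv]
  refine mul_le_mul_of_nonneg_left ?_ (by linarith [hp.2])
  refine (Finset.prod_le_prod h0 hle).trans_eq ?_
  rw [Finset.prod_ite_mem, Finset.prod_const, ← Real.exp_nat_mul]
  have : Finset.univ.erase v ∩ S = S := by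
    rw [Finset.inter_eq_right]
    intro u hu
    simp only [Finset.mem_erase, Finset.mem_univ, and_true]
    rintro rfl
    exact hv hu
  rw [this]
  congr 1
  ring

/-! ### Record probability at one place -/

/-- The chance, given the marked set, that an unmarked element is a record. -/
theorem card_isRecord_div_le {n : ℕ} (σ : Equiv.Perm (Fin n)) (M : Finset (Fin n)) (k : Fin n)
    (hk : σ k ∉ M) :
    ((Finset.univ.filter fun τ : Equiv.Perm {v : Fin n // v ∈ M} =>
        IsRecord (shuffle σ M τ) k).card : ℝ) / (M.card ! : ℝ) ≤
      exp (-((M ∩ (Finset.Iio k).map σ.toEmbedding).card * (M ∩ Finset.Ioi (σ k)).card /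
        M.card : ℝ)) := by
  set s : Finset {v : Fin n // v ∈ M} :=
    Finset.subtype (· ∈ M) ((Finset.Iio k).map σ.toEmbedding) with hs
  set b : Finset {v : Fin n // v ∈ M} := Finset.subtype (· ∈ M) (Finset.Ioi (σ k)) with hb
  have hcard : ∀ T : Finset (Fin n), (Finset.subtype (· ∈ M) T).card = (M ∩ T).card := by
    intro T
    rw [Finset.card_subtype, Finset.filter_mem_eq_inter, Finset.inter_comm]
  have hsub : (Finset.univ.filter fun τ : Equiv.Perm {v : Fin n // v ∈ M} =>
      IsRecord (shuffle σ M τ) k) ⊆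
      Finset.univ.filter fun τ : Equiv.Perm {v : Fin n // v ∈ M} => ∀ x ∈ s, τ x ∉ b := by
    intro τ hτ
    simp only [Finset.mem_filter, Finset.mem_univ, true_and] at hτ ⊢
    intro x hx hxb
    simp only [hs, Finset.mem_subtype, Finset.mem_map_equiv, Finset.mem_Iio] at hx
    simp only [hb, Finset.mem_subtype, Finset.mem_Ioi] at hxb
    have h := hτ _ hx
    simp only [shuffle, Equiv.Perm.mul_apply, Equiv.apply_symm_apply,
      Equiv.Perm.ofSubtype_apply_coe] at h
    rw [Equiv.Perm.ofSubtype_apply_of_not_mem _ hk] at h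
    exact absurd h hxb.not_gt
  have h1 := card_perm_mapsTo_compl_le s b
  rw [Fintype.card_coe] at h1
  have hfac : (0 : ℝ) < (M.card ! : ℝ) := by exact_mod_cast Nat.factorial_pos _
  rw [div_le_iff₀ hfac]
  refine (Nat.cast_le.mpr (Finset.card_le_card hsub)).trans (h1.trans ?_)
  rw [mul_comm, hcard, hcard]
  refine mul_le_mul_of_nonneg_right ?_ hfac.le
  have hq : 0 ≤ 1 - ((M ∩ Finset.Ioi (σ k)).card : ℝ) / M.card := by
    rw [sub_nonneg]
    exact div_le_one_of_le₀ (by exact_mod_cast Finset.card_le_card Finset.inter_subset_left)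
      (by positivity)
  refine (pow_le_pow_left₀ hq (Real.one_sub_le_exp_neg _) _).trans_eq ?_
  rw [← Real.exp_nat_mul]
  congr 1
  ring

/-- A pointwise union bound: each of the first three terms is at least 1 on one exceptional event,
and the last handles their complement. Being exponential in `m`, `i`, `j`, they can be averaged over
`M`. -/
theorem exp_neg_mul_div_le {m i j a b y q : ℝ} (hm : 0 ≤ m) (hi : 0 ≤ i) (hj : 0 ≤ j)
    (ha : 0 ≤ a) (hb : 0 ≤ b) (hq : 0 < q) (hy : 0 < y) (him : i ≤ m) :
    exp (-(i * j / m)) ≤ exp (m - 2 * y) + exp (q * a / 4 - i) + exp (q * b / 4 - j) +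
      exp (-(q ^ 2 * a * b / (32 * y))) := by
  have hle1 : exp (-(i * j / m)) ≤ 1 := by
    rw [Real.exp_le_one_iff, neg_nonpos]
    positivity
  have p1 := Real.exp_pos (m - 2 * y)
  have p2 := Real.exp_pos (q * a / 4 - i)
  have p3 := Real.exp_pos (q * b / 4 - j)
  have p4 := Real.exp_pos (-(q ^ 2 * a * b / (32 * y)))
  by_cases h1 : 2 * y ≤ m
  · have := Real.one_le_exp (sub_nonneg.mpr h1)
    linarith
  by_cases h2 : i ≤ q * a / 4
  · have := Real.one_le_exp (sub_nonneg.mpr h2)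
    linarith
  by_cases h3 : j ≤ q * b / 4
  · have := Real.one_le_exp (sub_nonneg.mpr h3)
    linarith
  push Not at h1 h2 h3
  have hqa : 0 ≤ q * a / 4 := by positivity
  have hqb : 0 ≤ q * b / 4 := by positivity
  have hmpos : 0 < m := by linarith
  have : exp (-(i * j / m)) ≤ exp (-(q ^ 2 * a * b / (32 * y))) := by
    rw [Real.exp_le_exp, neg_le_neg_iff]
    calc q ^ 2 * a * b / (32 * y) = (q * a / 4) * (q * b / 4) / (2 * y) := by
          field_simp
          ring
      _ ≤ i * j / m := by gcongr
  linarith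

theorem sum_markProb_mul_card_isRecord_le {n : ℕ} {p : ℝ} (hp : p ∈ Set.Icc (0 : ℝ) 1)
    (hp0 : 0 < p) (σ : Equiv.Perm (Fin n)) (k : Fin n) :
    ∑ M : Finset (Fin n) with σ k ∉ M, markProb p M *
      (((Finset.univ.filter fun τ : Equiv.Perm {v : Fin n // v ∈ M} =>
        IsRecord (shuffle σ M τ) k).card : ℝ) / (M.card ! : ℝ)) ≤
    (1 - p) * (exp (-(p * n / 4)) + exp (-(p / 4 * (k : ℕ))) +
      exp (-(p / 4 * ((σ k).rev : ℕ))) +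
      exp (-(p * (k : ℕ) * ((σ k).rev : ℕ) / (32 * n)))) := by
  have hn : 0 < n := k.pos
  have hn' : (0 : ℝ) < n := by exact_mod_cast hn
  have hq1 : 0 ≤ 1 - p := by linarith [hp.2]
  set A := (Finset.Iio k).map σ.toEmbedding with hA
  set B := Finset.Ioi (σ k) with hB
  have hAc : A.card = (k : ℕ) := by simp [hA]
  have hBc : B.card = ((σ k).rev : ℕ) := by
    simp [hB, Fin.val_rev]
    omega
  have hvA : σ k ∉ A := by simp [hA]
  have hvB : σ k ∉ B := by simp [hB]
  have e1 : exp (-1) ≤ 1 / 2 := by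
    rw [Real.exp_neg, inv_le_comm₀ (Real.exp_pos 1) (by norm_num)]
    linarith [Real.exp_one_gt_d9]
  -- Upper tail for `M.card`, two lower tails, and with `t = 0` the total mass of the sets avoiding
  -- `σ k`.
  have m1 := sum_markProb_mul_exp_le hp (Finset.notMem_erase (σ k) Finset.univ) 1
  have m2 := sum_markProb_mul_exp_le hp hvA (-1)
  have m3 := sum_markProb_mul_exp_le hp hvB (-1)
  have m4 := sum_markProb_mul_exp_le hp (Finset.notMem_empty (σ k)) 0
  set F := Finset.univ.filter fun M : Finset (Fin n) => σ k ∉ M with hF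
  set D : ℝ := exp (-(p ^ 2 * (k : ℕ) * ((σ k).rev : ℕ) / (32 * (p * n)))) with hD
  have hbound : ∀ M ∈ F, markProb p M *
      (((Finset.univ.filter fun τ : Equiv.Perm {v : Fin n // v ∈ M} =>
        IsRecord (shuffle σ M τ) k).card : ℝ) / (M.card ! : ℝ)) ≤
      exp (-(2 * (p * n))) *
        (markProb p M * exp (1 * ((M ∩ Finset.univ.erase (σ k)).card : ℝ))) +
      exp (p * (k : ℕ) / 4) * (markProb p M * exp (-1 * ((M ∩ A).card : ℝ))) +
      exp (p * ((σ k).rev : ℕ) / 4) * (markProb p M * exp (-1 * ((M ∩ B).card : ℝ))) +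
      D * (markProb p M * exp (0 * ((M ∩ ∅ : Finset (Fin n)).card : ℝ))) := by
    intro M hM
    have hM' : σ k ∉ M := by simpa [hF] using hM
    have hMe : M ∩ Finset.univ.erase (σ k) = M := by
      rw [Finset.inter_eq_left]
      intro u hu
      simp only [Finset.mem_erase, Finset.mem_univ, and_true]
      rintro rfl
      exact hM' hu
    have h1 := card_isRecord_div_le σ M k hM'
    have h2 := exp_neg_mul_div_le (m := M.card) (i := (M ∩ A).card) (j := (M ∩ B).card)
      (a := (k : ℕ)) (b := ((σ k).rev : ℕ)) (y := p * n) (q := p) (by positivity) (by positivity)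
      (by positivity) (by positivity) (by positivity) hp0 (by positivity)
      (by exact_mod_cast Finset.card_le_card Finset.inter_subset_left)
    refine (mul_le_mul_of_nonneg_left (h1.trans h2) (markProb_nonneg hp M)).trans_eq ?_
    rw [hMe, sub_eq_add_neg, sub_eq_add_neg, sub_eq_add_neg, Real.exp_add, Real.exp_add,
      Real.exp_add]
    simp only [one_mul, neg_mul, zero_mul, Real.exp_zero, ← hD]
    ring
  refine (Finset.sum_le_sum hbound).trans ?_
  simp only [Finset.sum_add_distrib, ← Finset.mul_sum]
  have g1 : exp (-(2 * (p * n))) * ((1 - p) *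
      exp (p * (Finset.univ.erase (σ k)).card * (exp 1 - 1))) ≤
      (1 - p) * exp (-(p * n / 4)) := by
    rw [mul_left_comm, ← Real.exp_add]
    refine mul_le_mul_of_nonneg_left (Real.exp_le_exp.mpr ?_) hq1
    have hc : ((Finset.univ.erase (σ k)).card : ℝ) ≤ n := by
      exact_mod_cast (Finset.card_le_univ _).trans_eq (Fintype.card_fin n)
    have he : exp 1 - 1 ≤ 7 / 4 := by linarith [Real.exp_one_lt_d9]
    have he0 : 0 ≤ exp 1 - 1 := by linarith [Real.exp_one_gt_d9]
    have : p * (Finset.univ.erase (σ k)).card * (exp 1 - 1) ≤ p * n * (7 / 4) := by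
      gcongr
    linarith
  -- Here `1/4 + (e⁻¹ - 1) ≤ -1/4`; in `g1` it was `-2 + (e - 1) ≤ -1/4`.
  have g2 : ∀ c : ℕ, exp (p * c / 4) * ((1 - p) * exp (p * c * (exp (-1) - 1))) ≤
      (1 - p) * exp (-(p / 4 * c)) := by
    intro c
    rw [mul_left_comm, ← Real.exp_add]
    refine mul_le_mul_of_nonneg_left (Real.exp_le_exp.mpr ?_) hq1
    have : 0 ≤ p * c := by positivity
    nlinarith
  have hD' : D = exp (-(p * (k : ℕ) * ((σ k).rev : ℕ) / (32 * n))) := by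
    rw [hD]
    congr 2
    field_simp
  have g3 := g2 k
  have g4 := g2 (σ k).rev
  rw [hAc] at m2
  rw [hBc] at m3
  have m1' := (mul_le_mul_of_nonneg_left m1 (Real.exp_pos (-(2 * (p * n)))).le).trans g1
  have m2' := (mul_le_mul_of_nonneg_left m2 (Real.exp_pos (p * (k : ℕ) / 4)).le).trans g3
  have m3' := (mul_le_mul_of_nonneg_left m3
    (Real.exp_pos (p * ((σ k).rev : ℕ) / 4)).le).trans g4
  have m4' := mul_le_mul_of_nonneg_left m4 (Real.exp_pos _ : 0 < D).le
  simp only [Finset.card_empty, Nat.cast_zero, mul_zero, zero_mul, Real.exp_zero, mul_one]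
    at m4' ⊢
  rw [← hD']
  linarith

/-! ### Summation over the places -/

theorem expectedUnmarkedRecords_eq {n : ℕ} (p : ℝ) (σ : Equiv.Perm (Fin n)) :
    expectedUnmarkedRecords p σ = ∑ k : Fin n, ∑ M : Finset (Fin n) with σ k ∉ M,
      markProb p M * (((Finset.univ.filter fun τ : Equiv.Perm {v : Fin n // v ∈ M} =>
        IsRecord (shuffle σ M τ) k).card : ℝ) / (M.card ! : ℝ)) := by
  simp only [Finset.sum_filter]
  rw [expectedUnmarkedRecords, Finset.sum_comm]
  refine Finset.sum_congr rfl fun M _ => ?_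
  have hmem : ∀ (τ : Equiv.Perm {v : Fin n // v ∈ M}) (k : Fin n),
      shuffle σ M τ k ∈ M ↔ σ k ∈ M := by
    intro τ k
    rw [shuffle, Equiv.Perm.mul_apply]
    by_cases h : σ k ∈ M
    · rw [Equiv.Perm.ofSubtype_apply_of_mem τ h]
      simp [h]
    · rw [Equiv.Perm.ofSubtype_apply_of_not_mem τ h]
  have hsum : (∑ τ : Equiv.Perm {v : Fin n // v ∈ M},
      (unmarkedRecords (shuffle σ M τ) M : ℝ)) = ∑ k : Fin n, if σ k ∉ M then
        ((Finset.univ.filter fun τ : Equiv.Perm {v : Fin n // v ∈ M} =>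
          IsRecord (shuffle σ M τ) k).card : ℝ) else 0 := by
    simp only [unmarkedRecords, hmem, Finset.card_filter, Nat.cast_sum]
    rw [Finset.sum_comm]
    refine Finset.sum_congr rfl fun k _ => ?_
    split_ifs with h <;> simp [h]
  rw [hsum, Finset.sum_div, Finset.mul_sum]
  refine Finset.sum_congr rfl fun k _ => ?_
  split_ifs <;> simp

theorem expectedUnmarkedRecords_le {n : ℕ} {p : ℝ} (hp : p ∈ Set.Icc (0 : ℝ) 1)
    (hnp : 1 ≤ n * p) (σ : Equiv.Perm (Fin n)) :
    expectedUnmarkedRecords p σ ≤ 50 * ((1 - p) * Real.sqrt ((n : ℝ) / p)) := by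
  have hp0 : 0 < p := by
    rcases hp.1.eq_or_lt with h | h
    · rw [← h] at hnp
      norm_num at hnp
    · exact h
  have hn' : (0 : ℝ) < n := by
    by_contra h
    nlinarith
  have hq1 : 0 ≤ 1 - p := by linarith [hp.2]
  set K := Real.sqrt ((n : ℝ) / p) with hK
  have hK2 : K * K = n / p := Real.mul_self_sqrt (by positivity)
  have hK0 : 0 < K := Real.sqrt_pos.mpr (by positivity)
  -- This is where `1 ≤ n * p` absorbs the `O(1/p)` tail sums into `K`.
  have hKp : 1 / p ≤ K := by
    refine Real.le_sqrt_of_sq_le ?_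
    rw [div_pow, one_pow, div_le_div_iff₀ (by positivity) hp0]
    nlinarith
  have hK1 : 1 ≤ K := by
    refine le_trans ?_ hKp
    rw [le_div_iff₀ hp0]
    linarith [hp.2]
  have hrev : ∀ f : ℕ → ℝ, ∑ k : Fin n, f ((σ k).rev : ℕ) = ∑ k : Fin n, f k := fun f =>
    Equiv.sum_comp (σ.trans Fin.revPerm) fun k : Fin n => f k
  have s1 : ∑ _k : Fin n, exp (-(p * n / 4)) ≤ K := by
    rw [Finset.sum_const, Finset.card_univ, Fintype.card_fin, nsmul_eq_mul]
    have h1 : exp (-(p * n / 4)) * (p * n / 4 + 1) ≤ 1 := by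
      calc exp (-(p * n / 4)) * (p * n / 4 + 1) ≤ exp (-(p * n / 4)) * exp (p * n / 4) := by
            gcongr
            exact Real.add_one_le_exp _
        _ = 1 := by rw [← Real.exp_add]; simp
    have h2 : (n : ℝ) = p * K * K := by
      rw [mul_assoc, hK2]
      field_simp
    -- With `x = p * K`, so that `x ^ 2 = p * n`, this is `(x/2 - 1) ^ 2 ≥ 0`.
    have h3 : p * K ≤ p * n / 4 + 1 := by
      have h4 : p * n = (p * K) ^ 2 := by
        rw [h2]
        ring
      rw [h4]
      nlinarith [sq_nonneg (p * K / 2 - 1)]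
    have hE := Real.exp_pos (-(p * n / 4))
    calc (n : ℝ) * exp (-(p * n / 4)) = K * (exp (-(p * n / 4)) * (p * K)) := by
          nth_rw 1 [h2]
          ring
      _ ≤ K * (exp (-(p * n / 4)) * (p * n / 4 + 1)) := by gcongr
      _ ≤ K * 1 := by gcongr
      _ = K := mul_one K
  have s2 : ∑ k : Fin n, exp (-(p / 4 * (k : ℕ))) ≤ 5 * K := by
    refine (sum_exp_neg_mul_le (by positivity) n).trans ?_
    have : 1 / (p / 4) = 4 * (1 / p) := by field_simp
    linarith
  have s3 : ∑ k : Fin n, exp (-(p / 4 * ((σ k).rev : ℕ))) ≤ 5 * K :=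
    (hrev fun b => exp (-(p / 4 * b))).trans_le s2
  have s4 : ∑ k : Fin n, exp (-(p * (k : ℕ) * ((σ k).rev : ℕ) / (32 * n))) ≤ 39 * K := by
    -- Split at `(σ k).rev = K`. Below it the bound 1 is replaced by `3 * exp (-(rev/K))`, valid as
    -- `e ≤ 3`, so that both cases become geometric sums.
    have hb : ∀ k : Fin n, exp (-(p * (k : ℕ) * ((σ k).rev : ℕ) / (32 * n))) ≤
        exp (-(1 / (32 * K) * (k : ℕ))) + 3 * exp (-(1 / K * ((σ k).rev : ℕ))) := by
      intro k
      have p1 := Real.exp_pos (-(1 / (32 * K) * ((k : ℕ) : ℝ)))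
      have p2 := Real.exp_pos (-(1 / K * (((σ k).rev : ℕ) : ℝ)))
      rcases le_total K ((σ k).rev : ℕ) with h | h
      · have : exp (-(p * (k : ℕ) * ((σ k).rev : ℕ) / (32 * n))) ≤
            exp (-(1 / (32 * K) * (k : ℕ))) := by
          rw [Real.exp_le_exp, neg_le_neg_iff]
          have h2 : (n : ℝ) = p * K * K := by
            rw [mul_assoc, hK2]
            field_simp
          calc 1 / (32 * K) * ((k : ℕ) : ℝ) = p * (k : ℕ) * K / (32 * n) := by
                rw [h2]
                field_simp
            _ ≤ _ := by gcongr
        linarith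
      · have h1 : exp (-(p * (k : ℕ) * ((σ k).rev : ℕ) / (32 * n))) ≤ 1 := by
          rw [Real.exp_le_one_iff, neg_nonpos]
          positivity
        have h2 : exp (-1) ≤ exp (-(1 / K * ((σ k).rev : ℕ))) := by
          rw [Real.exp_le_exp, neg_le_neg_iff, one_div, inv_mul_le_iff₀ hK0]
          linarith
        have h3 : 1 ≤ 3 * exp (-1) := by
          rw [Real.exp_neg, ← div_eq_mul_inv, le_div_iff₀ (Real.exp_pos 1)]
          linarith [Real.exp_one_lt_d9]
        linarith
    refine (Finset.sum_le_sum fun k _ => hb k).trans ?_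
    rw [Finset.sum_add_distrib, ← Finset.mul_sum, hrev fun b => exp (-(1 / K * b))]
    have t1 := sum_exp_neg_mul_le (c := 1 / (32 * K)) (by positivity) n
    have t2 := sum_exp_neg_mul_le (c := 1 / K) (by positivity) n
    rw [one_div_one_div] at t1 t2
    linarith
  rw [expectedUnmarkedRecords_eq]
  refine (Finset.sum_le_sum fun k _ => sum_markProb_mul_card_isRecord_le hp hp0 σ k).trans ?_
  rw [← Finset.mul_sum, mul_left_comm]
  refine mul_le_mul_of_nonneg_left ?_ hq1
  simp only [Finset.sum_add_distrib]
  linarith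

end PartialPermutation

theorem theorem1 :
    ∃ C : ℝ, ∀ p : ℕ → ℝ, (∀ n, p n ∈ Set.Icc (0 : ℝ) 1) →
      Filter.Tendsto (fun n : ℕ => (n : ℝ) * p n) Filter.atTop Filter.atTop →
      ∀ᶠ n : ℕ in Filter.atTop,
        PartialPermutation.maxExpectedUnmarkedRecords n (p n) ≤
          C * ((1 - p n) * Real.sqrt ((n : ℝ) / p n)) := by
  refine ⟨50, fun p hp hlim => ?_⟩
  filter_upwards [hlim.eventually_ge_atTop 1] with n hn
  exact Finset.sup'_le _ _ fun σ _ =>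
    PartialPermutation.expectedUnmarkedRecords_le (hp n) hn σ
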